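/- Let $K_{m,n}$ be the complete bipartite graph with classes $M$, $N$ of sizes $m$ and $n$. A path in an edge-coloured graph is \emph{alternating} if any two adjacent edges of it have different colours. For $r,k\ge 1$ let $\kappa_{r,2k}(m,n)$ be the maximum $t$ for which there is an $r$-colouring of the edges of $K_{m,n}$ such that any two distinct vertices of $N$ (the class of size $n$) are connected by $t$ internally disjoint alternating paths of length $2k$ (that is, with $2k$ edges). Let $r\ge 2$ and $k\ge 2$ be fixed integers, and let $m=m(n)$ be a sequence of positive integers with $m(n)\le n$ and $m(n)\to\infty$ as $n\to\infty$. Then \[ \kappa_{r,2k}(m,n)\sim \frac{m}{k}\qquad (n\to\infty). \] Moreover, two colours already suffice: there are integers $t(n)\ge 0$ with $t(n)\sim m/k$ such that, for all sufficiently large $n$, some $r$-colouring of the edges of $K_{m,n}$ using at most two of the $r$ colours connects any two distinct vertices of $N$ by $t(n)$ internally disjoint alternating paths of length $2k$. -/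

import Mathlib

open Filter Asymptotics

namespace AltPaths

variable {V K : Type*} {G : SimpleGraph V}

/-- A walk in an edge-coloured graph is alternating if any two consecutive edges of it have
different colours. -/
def IsAlternating (c : G.EdgeLabeling K) {u v : V} (p : G.Walk u v) : Prop :=
  p.darts.IsChain fun d e => c ⟨d.edge, d.edge_mem⟩ ≠ c ⟨e.edge, e.edge_mem⟩

/-- `u` and `v` are connected by `t` (distinct) internally disjoint alternating paths, each with
exactly `ℓ` edges. -/
def JoinedBy (c : G.EdgeLabeling K) (ℓ t : ℕ) (u v : V) : Prop :=
  ∃ P : Fin t → G.Walk u v,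
    Function.Injective P ∧
    (∀ i, (P i).IsPath ∧ (P i).length = ℓ ∧ IsAlternating c (P i)) ∧
    ∀ i j, i ≠ j → ∀ x, x ∈ (P i).support → x ∈ (P j).support → x = u ∨ x = v

/-- The complete bipartite graph `K_{m,n}`; its classes are the left copy of `Fin m` and the right
copy of `Fin n`. -/
abbrev Kmn (m n : ℕ) : SimpleGraph (Fin m ⊕ Fin n) :=
  completeBipartiteGraph (Fin m) (Fin n)

/-- Under the colouring `c` of `K_{m,n}`, any two distinct vertices of the class of size `n` are
connected by `t` internally disjoint alternating paths of length `ℓ`. -/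
def Connects {m n : ℕ} (c : (Kmn m n).EdgeLabeling K) (ℓ t : ℕ) : Prop :=
  ∀ u v : Fin n, u ≠ v → JoinedBy c ℓ t (Sum.inr u) (Sum.inr v)

/-- `κ_{r,ℓ}(m,n)`: the maximum `t` such that some colouring of the edges of `K_{m,n}` with colours
`Fin r` connects any two vertices of the class of size `n` by `t` internally disjoint alternating
paths of length `ℓ`. It is a genuine maximum as soon as `2 ≤ n`, `1 ≤ r` and `2 ≤ ℓ`, see
`isGreatest_kappa`. -/
noncomputable def kappa (r ℓ m n : ℕ) : ℕ :=
  sSup {t : ℕ | ∃ c : (Kmn m n).EdgeLabeling (Fin r), Connects c ℓ t}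

theorem isGreatest_kappa {r ℓ m n : ℕ} (hr : 1 ≤ r) (hℓ : 2 ≤ ℓ) (hn : 2 ≤ n) :
    IsGreatest {t : ℕ | ∃ c : (Kmn m n).EdgeLabeling (Fin r), Connects c ℓ t}
      (kappa r ℓ m n) := by
  have hb : BddAbove {t : ℕ | ∃ c : (Kmn m n).EdgeLabeling (Fin r), Connects c ℓ t} := by
    refine ⟨Fintype.card (Fin m ⊕ Fin n), ?_⟩
    rintro t ⟨c, hc⟩
    obtain ⟨P, -, hP, hd⟩ := hc ⟨0, by omega⟩ ⟨1, by omega⟩ (by simp)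
    have hinj : Function.Injective fun i => (P i).getVert 1 := by
      intro i j hij
      by_contra hne
      have h1 := hd i j hne ((P i).getVert 1) ((P i).getVert_mem_support 1)
        (by simp only at hij; rw [hij]; exact (P j).getVert_mem_support 1)
      obtain ⟨hp, hl, -⟩ := hP i
      have hi := hp.getVert_injOn
      rcases h1 with h | h
      · have := hi (x₁ := 1) (x₂ := 0) (by simp; omega) (by simp) (by simpa using h)
        omega
      · have := hi (x₁ := 1) (x₂ := (P i).length) (by simp; omega) (by simp) (by simpa using h)
        omega
    simpa using Fintype.card_le_of_injective _ hinj
  refine ⟨Nat.sSup_mem ⟨0, fun _ => ⟨0, hr⟩, ?_⟩ hb, fun t ht => le_csSup hb ht⟩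
  intro u v _
  exact ⟨fun i => i.elim0, fun i => i.elim0, fun i => i.elim0, fun i => i.elim0⟩

end AltPaths

/-!
For the upper bound, a path of length `2 * k` between vertices of `N` has `k` interior vertices in
`M`, so `t` internally disjoint ones give `k * t ≤ m`.

For the lower bound, Lindsey's lemma shows that a Hadamard matrix of order less than `s ^ 2` has no
constant `s × s` submatrix, and pairing each row with its negative makes the columns balanced. Take
the entries as colours. Given `u` and `v`, split `M` and the first `m` vertices of `N` into levels
that form two chains, one for each colour `b` of the first edge: the first level of a chain consists
of neighbours of `u` in colour `b`, the last one of neighbours of `v` in colour `!b`, and the others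
are arbitrary. Consecutive levels are linked by greedy matchings in the prescribed colour, each of
which loses only `s = O(√m)` vertices, so each chain carries `m / (2 * k) - O(√m)` paths.
-/

namespace AltPaths

open Finset
open scoped Kronecker

section Mixing

variable {α β : Type*}

/-- Any `s` elements of `X` and any `s` elements of `Y` contain a related pair; that is, the
bipartite graph `R` between `X` and `Y` has no `s × s` hole. -/
def IsMixing (R : α → β → Prop) (s : ℕ) (X : Finset α) (Y : Finset β) : Prop :=
  ∀ X' ⊆ X, ∀ Y' ⊆ Y, s ≤ #X' → s ≤ #Y' → ∃ x ∈ X', ∃ y ∈ Y', R x y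

variable {R : α → β → Prop} {s : ℕ} {X X' : Finset α} {Y Y' : Finset β}

theorem IsMixing.mono (h : IsMixing R s X Y) (hX : X' ⊆ X) (hY : Y' ⊆ Y) : IsMixing R s X' Y' :=
  fun A hA B hB => h A (hA.trans hX) B (hB.trans hY)

theorem IsMixing.symm {R : α → α → Prop} {X Y : Finset α} (h : IsMixing R s X Y)
    (hR : ∀ ⦃x y⦄, R x y → R y x) : IsMixing R s Y X := fun B hB A hA hBs hAs =>
  let ⟨x, hx, y, hy, hxy⟩ := h A hA B hB hAs hBs
  ⟨y, hy, x, hx, hR hxy⟩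

theorem IsMixing.map {α' β' : Type*} {R' : α' → β' → Prop} (h : IsMixing R s X Y)
    (f : α ↪ α') (g : β ↪ β') (hR : ∀ x y, R x y → R' (f x) (g y)) :
    IsMixing R' s (X.map f) (Y.map g) := by
  intro X' hX' Y' hY' hXs hYs
  obtain ⟨A, hA, rfl⟩ := subset_map_iff.1 hX'
  obtain ⟨B, hB, rfl⟩ := subset_map_iff.1 hY'
  obtain ⟨x, hx, y, hy, hxy⟩ := h A hA B hB (by simpa using hXs) (by simpa using hYs)
  exact ⟨f x, mem_map_of_mem f hx, g y, mem_map_of_mem g hy, hR x y hxy⟩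

theorem IsMixing.exists_matching (h : IsMixing R s X Y) {d : ℕ} (hX : d + s ≤ #X)
    (hY : d + s ≤ #Y) :
    ∃ (f : Fin d → α) (g : Fin d → β), f.Injective ∧ g.Injective ∧
      ∀ i, f i ∈ X ∧ g i ∈ Y ∧ R (f i) (g i) := by
  classical
  induction d generalizing X Y with
  | zero => exact ⟨Fin.elim0, Fin.elim0, fun i => i.elim0, fun i => i.elim0, fun i => i.elim0⟩
  | succ d ih =>
    obtain ⟨x, hx, y, hy, hxy⟩ := h X subset_rfl Y subset_rfl (by omega) (by omega)
    obtain ⟨f, g, hf, hg, hfg⟩ := ih (h.mono (X.erase_subset x) (Y.erase_subset y))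
      (by rw [card_erase_of_mem hx]; omega) (by rw [card_erase_of_mem hy]; omega)
    simp only [mem_erase] at hfg
    have hx_notin : x ∉ Set.range f := fun ⟨i, hi⟩ => (hfg i).1.1 hi
    have hy_notin : y ∉ Set.range g := fun ⟨i, hi⟩ => (hfg i).2.1.1 hi
    exact ⟨Fin.cons x f, Fin.cons y g, Fin.cons_injective_iff.2 ⟨hx_notin, hf⟩,
      Fin.cons_injective_iff.2 ⟨hy_notin, hg⟩,
      Fin.cases ⟨hx, hy, hxy⟩ fun i => ⟨(hfg i).1.2, (hfg i).2.1.2, (hfg i).2.2⟩⟩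

theorem exists_disjoint_transversals {L : ℕ → Finset α} {R : ℕ → α → α → Prop} {s ℓ d : ℕ}
    (hL : ∀ i ≤ ℓ, d + ℓ * s ≤ #(L i)) (hR : ∀ i < ℓ, IsMixing (R i) s (L i) (L (i + 1))) :
    ∃ P : Fin d → ℕ → α, (∀ j, ∀ i ≤ ℓ, P j i ∈ L i) ∧
      (∀ j, ∀ i < ℓ, R i (P j i) (P j (i + 1))) ∧ ∀ i ≤ ℓ, Function.Injective fun j => P j i := by
  classical
  induction ℓ generalizing L R d with
  | zero =>
    obtain ⟨e⟩ : Nonempty (Fin d ↪ L 0) :=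
      Function.Embedding.nonempty_of_card_le (by simpa using hL 0 le_rfl)
    exact ⟨fun j _ => e j, by simp, by simp, fun i _ => Subtype.val_injective.comp e.injective⟩
  | succ ℓ ih =>
    simp only [add_one_mul] at hL
    -- Lose `s` of the paths through the later levels when matching them with the first level.
    obtain ⟨P, hPL, hPR, hPinj⟩ := ih (L := fun i => L (i + 1)) (R := fun i => R (i + 1))
      (d := d + s) (fun i hi => by have := hL (i + 1) (by omega); omega)
      (fun i hi => hR (i + 1) (by omega))
    have hsub : univ.image (P · 0) ⊆ L 1 := image_subset_iff.2 fun j _ => hPL j 0 (by omega)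
    obtain ⟨f, g, hf, hg, hfg⟩ :=
      ((hR 0 (by omega)).mono subset_rfl hsub).exists_matching (d := d)
        (by have := hL 0 (by omega); omega)
        (by rw [card_image_of_injective _ (hPinj 0 (by omega)), card_fin])
    choose π hπ using fun j => (mem_image_univ_iff_mem_range.1 (hfg j).2.1)
    have hπ_inj : π.Injective := fun i j hij => hg (by rw [← hπ, ← hπ, hij])
    refine ⟨fun j i => i.casesOn (f j) (P (π j)), fun j i hi => ?_, fun j i hi => ?_,
      fun i hi => ?_⟩ <;> rcases i with _ | i
    · exact (hfg j).1
    · exact hPL _ i (by omega)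
    · change R 0 (f j) (P (π j) 0)
      rw [show P (π j) 0 = g j from hπ j]
      exact (hfg j).2.2
    · exact hPR _ i (by omega)
    · exact hf
    · exact (hPinj i (by omega)).comp hπ_inj

end Mixing

section Equidistribution

variable {α β ι : Type*} [Fintype ι] [Nonempty ι] [DecidableEq ι]

theorem exists_equidistributed (X : Finset α) :
    ∃ g : α → ι, ∀ j, #X ≤ Fintype.card ι * (#{x ∈ X | g x = j} + 1) := by
  classical
  let q := #X / Fintype.card ι
  obtain ⟨e⟩ : Nonempty (ι × Fin q ↪ X) := Function.Embedding.nonempty_of_card_le (by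
    simpa using Nat.mul_div_le _ _)
  have he : Function.Injective fun p => (e p : α) := Subtype.val_injective.comp e.injective
  let g : α → ι := Function.extend (fun p => (e p : α)) Prod.fst fun _ => Classical.arbitrary ι
  have hg (p) : g (e p) = p.1 := he.extend_apply _ _ p
  refine ⟨g, fun j => ?_⟩
  have hq : q ≤ #{x ∈ X | g x = j} := calc
    q = #(univ.image fun i : Fin q => (e (j, i) : α)) := by
      rw [card_image_of_injective _ fun a b hab => (Prod.ext_iff.1 (he hab)).2, card_fin]
    _ ≤ #{x ∈ X | g x = j} := card_le_card (by simp [image_subset_iff, hg])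
  exact (Nat.lt_mul_div_succ _ Fintype.card_pos).le.trans (by gcongr)

theorem exists_equidistributed_fibers [DecidableEq β] (X : Finset α) (f : α → β) :
    ∃ g : α → ι, ∀ T : Finset β, ∀ j,
      #{x ∈ X | f x ∈ T} ≤ Fintype.card ι * (#{x ∈ X | f x ∈ T ∧ g x = j} + #T) := by
  choose g hg using fun c => exists_equidistributed (ι := ι) {x ∈ X | f x = c}
  refine ⟨fun x => g (f x) x, fun T j => ?_⟩
  have hfiber : ∀ c ∈ T, {x ∈ {x ∈ X | f x ∈ T} | f x = c} = {x ∈ X | f x = c} := by grind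
  have hfiber' : ∀ c ∈ T, {x ∈ {x ∈ X | f x ∈ T ∧ g (f x) x = j} | f x = c} =
      {x ∈ {x ∈ X | f x = c} | g c x = j} := by grind
  calc #{x ∈ X | f x ∈ T} = ∑ c ∈ T, #{x ∈ X | f x = c} := by
        rw [card_eq_sum_card_fiberwise (f := f) (t := T) (by simp [Set.MapsTo])]
        exact sum_congr rfl fun c hc => congrArg card (hfiber c hc)
    _ ≤ ∑ c ∈ T, Fintype.card ι * (#{x ∈ {x ∈ X | f x = c} | g c x = j} + 1) :=
        sum_le_sum fun c _ => hg c j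
    _ = Fintype.card ι * (#{x ∈ X | f x ∈ T ∧ g (f x) x = j} + #T) := by
        rw [card_eq_sum_card_fiberwise (f := f) (t := T) (by simp +contextual [Set.MapsTo]),
          ← mul_sum, sum_add_distrib, sum_congr rfl fun c hc => congrArg card (hfiber' c hc),
          sum_const, smul_eq_mul, mul_one]

end Equidistribution

section Hadamard

variable {ι α β : Type*} [Fintype ι] [DecidableEq ι] {H : Matrix ι ι ℤ}

/-- Lindsey's lemma. -/
theorem sq_sum_sum_le_of_isHadamard (hH : H.IsHadamard) (A X : Finset ι) :
    (∑ x ∈ X, ∑ a ∈ A, H a x) ^ 2 ≤ #A * #X * Fintype.card ι := by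
  have horth (a b : ι) : ∑ x, H a x * H b x = if a = b then (Fintype.card ι : ℤ) else 0 := by
    simpa [Matrix.mul_apply, Matrix.one_apply] using congr_fun₂ hH.mul_conjTranspose a b
  calc (∑ x ∈ X, ∑ a ∈ A, H a x) ^ 2 ≤ #X * ∑ x ∈ X, (∑ a ∈ A, H a x) ^ 2 :=
        sq_sum_le_card_mul_sum_sq
    _ ≤ #X * ∑ x, (∑ a ∈ A, H a x) ^ 2 := by
        gcongr
        exact X.subset_univ
    _ = #X * ∑ a ∈ A, ∑ b ∈ A, ∑ x, H a x * H b x := by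
        simp only [sq, sum_mul_sum]
        rw [sum_comm]
        simp only [sum_comm (s := univ)]
    _ = #A * #X * Fintype.card ι := by
        simp only [horth, sum_ite_eq]
        rw [sum_congr rfl fun a ha => if_pos ha, sum_const, nsmul_eq_mul]
        ring

theorem isMixing_of_isHadamard (hH : H.IsHadamard) {s : ℕ} (hs : Fintype.card ι < s * s)
    {r : α → ι} {c : β → ι} {A : Finset α} {X : Finset β} (hr : Set.InjOn r A)
    (hc : Set.InjOn c X) {ε : ℤ} (hε : ε = 1 ∨ ε = -1) :
    IsMixing (fun a x => H (r a) (c x) = ε) s A X := by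
  classical
  intro A' hA' X' hX' hAs hXs
  by_contra! hne
  have hconst : ∑ x ∈ X'.image c, ∑ a ∈ A'.image r, H a x = #A' * #X' * -ε := by
    rw [← card_image_of_injOn (hr.mono hA'), ← card_image_of_injOn (hc.mono hX'),
      sum_congr rfl fun x hx => sum_congr rfl fun a ha => (?_ : H a x = -ε)]
    · simp only [sum_const, nsmul_eq_mul]
      ring
    · obtain ⟨x, hx, rfl⟩ := mem_image.1 hx
      obtain ⟨a, ha, rfl⟩ := mem_image.1 ha
      have := Unitary.mem_iff_eq_one_or_eq_neg_one.mp (hH.apply_mem (r a) (c x))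
      grind
  have hlindsey := sq_sum_sum_le_of_isHadamard hH (A'.image r) (X'.image c)
  rw [hconst, card_image_of_injOn (hr.mono hA'), card_image_of_injOn (hc.mono hX'), mul_pow,
    show (-ε) ^ 2 = 1 by rcases hε with rfl | rfl <;> rfl, mul_one, sq] at hlindsey
  have hlarge : Fintype.card ι < #A' * #X' := hs.trans_le (Nat.mul_le_mul hAs hXs)
  have hpos : 0 < #A' * #X' := hlarge.pos
  exact (le_of_mul_le_mul_left (mod_cast hlindsey) hpos).not_gt hlarge

/-- The Hadamard matrix of order `2`; Kronecker products with it double the order of a Hadamard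
matrix and pair each row with a row opposite to it on half of the columns. -/
def hadamardTwo : Matrix (Fin 2) (Fin 2) ℤ := !![1, 1; 1, -1]

theorem isHadamard_hadamardTwo : hadamardTwo.IsHadamard where
  apply_mem := by simp [Unitary.mem_iff_eq_one_or_eq_neg_one, Fin.forall_fin_two, hadamardTwo]
  mul_conjTranspose := by decide
  conjTranspose_mul := by decide

theorem exists_isHadamard_two_pow (q : ℕ) :
    ∃ H : Matrix (Fin (2 ^ q)) (Fin (2 ^ q)) ℤ, H.IsHadamard := by
  induction q with
  | zero => exact ⟨1, by constructor <;> simp [Matrix.one_apply, one_mem]⟩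
  | succ q ih =>
    obtain ⟨H, hH⟩ := ih
    let e : Fin 2 × Fin (2 ^ q) ≃ Fin (2 ^ (q + 1)) :=
      finProdFinEquiv.trans (finCongr (pow_succ' 2 q).symm)
    exact ⟨_, (isHadamard_hadamardTwo.kronecker hH).reindex e e⟩

theorem exists_isHadamard_of_pos {m : ℕ} (hm : 0 < m) :
    ∃ N, m < N ∧ N ≤ 2 * m ∧ ∃ H : Matrix (Fin N) (Fin N) ℤ, H.IsHadamard := by
  refine ⟨_, Nat.lt_pow_succ_log_self one_lt_two m, ?_, exists_isHadamard_two_pow _⟩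
  rw [pow_succ']
  exact Nat.mul_le_mul_left 2 (Nat.pow_log_le_self 2 hm.ne')

theorem half_le_card_filter_of_alternate {m : ℕ} {f : ℕ → Bool}
    (hf : ∀ i, f (2 * i + 1) = !f (2 * i)) (b : Bool) : m / 2 ≤ #{a : Fin m | f a = b} := by
  have hsurj : Set.SurjOn (fun a : Fin m => a.val / 2) ({a | f a = b} : Finset (Fin m))
      (range (m / 2)) := by
    intro i hi
    simp only [coe_range, Set.mem_Iio] at hi
    by_cases hb : f (2 * i) = b
    · exact ⟨⟨2 * i, by omega⟩, by simpa using hb, by simp⟩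
    · exact ⟨⟨2 * i + 1, by omega⟩, by simpa [hf, ← Bool.eq_not] using hb,
        show (2 * i + 1) / 2 = i by omega⟩
  simpa using card_le_card_of_surjOn _ hsurj

theorem hadamardTwo_kronecker_one_one (H : Matrix α β ℤ) (i : α) (j : β) :
    (hadamardTwo ⊗ₖ H) (1, i) (1, j) = -(hadamardTwo ⊗ₖ H) (0, i) (1, j) := by
  simp [hadamardTwo]

theorem exists_balanced_mixing_matrix {m : ℕ} (hm : 0 < m) (n : ℕ) :
    ∃ M : Fin m → Fin n → Bool, (∀ x b, m / 2 ≤ #{a | M a x = b}) ∧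
      ∀ b, IsMixing (fun a x => M a x = b) (4 * m.sqrt) univ {x | x.val < m} := by
  obtain ⟨N, hmN, hNm, H, hH⟩ := exists_isHadamard_of_pos hm
  have : NeZero N := ⟨by omega⟩
  have hK := isHadamard_hadamardTwo.kronecker hH
  let row (a : ℕ) : Fin 2 × Fin N := (Fin.ofNat 2 a, Fin.ofNat N (a / 2))
  -- Only the second block of columns is used: there, rows `2 * i` and `2 * i + 1` are opposite.
  let col (x : ℕ) : Fin 2 × Fin N := (1, Fin.ofNat N x)
  let entry (a x : ℕ) : ℤ := (hadamardTwo ⊗ₖ H) (row a) (col x)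
  have hentry (a x : ℕ) : entry a x = 1 ∨ entry a x = -1 :=
    Unitary.mem_iff_eq_one_or_eq_neg_one.mp (hK.apply_mem _ _)
  have halternate (i x : ℕ) : entry (2 * i + 1) x = -entry (2 * i) x := by
    have heven : row (2 * i) = (0, Fin.ofNat N i) := by
      simp [row, Fin.ext_iff]
    have hodd : row (2 * i + 1) = (1, Fin.ofNat N i) := by
      simp [row, Fin.ext_iff, show (2 * i + 1) / 2 = i by omega]
    simp only [entry, heven, hodd, col, hadamardTwo_kronecker_one_one]
  refine ⟨fun a x => decide (entry a x = 1), fun x => half_le_card_filter_of_alternate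
    (f := fun a => decide (entry a x = 1)) fun i => ?_, fun b => ?_⟩
  · rcases hentry (2 * i) x with h | h <;> simp [halternate, h]
  · have hcard : Fintype.card (Fin 2 × Fin N) < 4 * m.sqrt * (4 * m.sqrt) := by
      have := Nat.lt_succ_sqrt m
      have := Nat.sqrt_pos.2 hm
      simp only [Fintype.card_prod, Fintype.card_fin]
      nlinarith
    have hmix : IsMixing (fun (a : Fin m) (x : Fin n) => entry a x = if b then 1 else -1)
        (4 * m.sqrt) univ {x | x.val < m} := by
      refine isMixing_of_isHadamard hK hcard (r := fun a : Fin m => row a)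
        (c := fun x : Fin n => col x) ?_ ?_ (by cases b <;> simp)
      · intro a _ a' _ h
        simp only [row, Prod.ext_iff, Fin.ext_iff, Fin.val_ofNat] at h
        rw [Nat.mod_eq_of_lt (show a.val / 2 < N by omega),
          Nat.mod_eq_of_lt (show a'.val / 2 < N by omega)] at h
        omega
      · intro x hx x' hx' h
        simp only [coe_filter, mem_univ, true_and, Set.mem_ofPred_eq] at hx hx'
        simp only [col, Prod.ext_iff, Fin.ext_iff, Fin.val_ofNat] at h
        rw [Nat.mod_eq_of_lt (by omega), Nat.mod_eq_of_lt (by omega)] at h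
        omega
    convert hmix using 3 with a x
    rcases hentry a x with h | h <;> cases b <;> simp [h]

end Hadamard

section AlternatingPaths

variable {V K : Type*} {G : SimpleGraph V} {c : G.EdgeLabeling K} {u v : V} {ℓ : ℕ}

theorem exists_walk_getVert_eq {g : ℕ → V} (hadj : ∀ i < ℓ, G.Adj (g i) (g (i + 1)))
    (hu : g 0 = u) (hv : g ℓ = v) :
    ∃ p : G.Walk u v, p.length = ℓ ∧ ∀ i ≤ ℓ, p.getVert i = g i := by
  subst hu hv
  induction ℓ generalizing g with
  | zero => exact ⟨.nil, rfl, fun i hi => by simp [Nat.le_zero.1 hi]⟩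
  | succ ℓ ih =>
    obtain ⟨p, hp, hpg⟩ := ih (g := fun i => g (i + 1)) fun i hi => hadj (i + 1) (by omega)
    refine ⟨.cons (hadj 0 (by omega)) p, by simp [hp], fun i hi => ?_⟩
    rcases i with _ | i
    · simp
    · simpa using hpg i (by omega)

theorem exists_alternating_path {κ : ℕ → K} (hκ : ∀ i, κ i ≠ κ (i + 1)) {g : ℕ → V}
    (hadj : ∀ i < ℓ, (c.labelGraph (κ i)).Adj (g i) (g (i + 1)))
    (hg : Set.InjOn g {i | i ≤ ℓ}) (hu : g 0 = u) (hv : g ℓ = v) :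
    ∃ p : G.Walk u v, (p.IsPath ∧ p.length = ℓ ∧ IsAlternating c p) ∧
      ∀ x ∈ p.support, ∃ i ≤ ℓ, g i = x := by
  simp only [SimpleGraph.EdgeLabeling.labelGraph_adj] at hadj
  choose hadj hcolor using hadj
  obtain ⟨p, hp, hpg⟩ := exists_walk_getVert_eq hadj hu hv
  refine ⟨p, ⟨?_, hp, ?_⟩, fun x hx => ?_⟩
  · rw [← SimpleGraph.Walk.IsPath.getVert_injOn_iff, hp]
    exact hg.congr fun i hi => (hpg i hi).symm
  · rw [IsAlternating, List.isChain_iff_getElem]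
    intro i hi
    rw [SimpleGraph.Walk.length_darts, hp] at hi
    simp only [SimpleGraph.Walk.darts_getElem_eq_getVert, SimpleGraph.Dart.edge_mk,
      hpg i (by omega), hpg (i + 1) (by omega), hpg (i + 1 + 1) (by omega),
      hcolor i (by omega), hcolor (i + 1) hi]
    exact hκ i
  · obtain ⟨i, rfl, hi⟩ := SimpleGraph.Walk.mem_support_iff_exists_getVert.1 hx
    exact ⟨i, hp ▸ hi, (hpg i (hp ▸ hi)).symm⟩

theorem exists_alternating_path_of_interior {κ : ℕ → K} (hκ : ∀ i, κ i ≠ κ (i + 1)) {P : ℕ → V}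
    (hstart : (c.labelGraph (κ 0)).Adj u (P 0))
    (hadj : ∀ i < ℓ, (c.labelGraph (κ (i + 1))).Adj (P i) (P (i + 1)))
    (hend : (c.labelGraph (κ (ℓ + 1))).Adj (P ℓ) v) (hP : Set.InjOn P {i | i ≤ ℓ}) (huv : u ≠ v)
    (hu : ∀ i ≤ ℓ, P i ≠ u) (hv : ∀ i ≤ ℓ, P i ≠ v) :
    ∃ p : G.Walk u v, (p.IsPath ∧ p.length = ℓ + 2 ∧ IsAlternating c p) ∧
      ∀ x ∈ p.support, x = u ∨ x = v ∨ ∃ i ≤ ℓ, P i = x := by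
  let g : ℕ → V := fun i => i.casesOn u fun i => if i ≤ ℓ then P i else v
  have hsucc (i : ℕ) : g (i + 1) = if i ≤ ℓ then P i else v := rfl
  have hgadj (i : ℕ) (hi : i < ℓ + 2) : (c.labelGraph (κ i)).Adj (g i) (g (i + 1)) := by
    rcases i with _ | i
    · exact hstart
    · obtain hi' | rfl : i < ℓ ∨ i = ℓ := by omega
      · simpa [hsucc, hi', hi'.le] using hadj i hi'
      · simpa [hsucc] using hend
  have hginj : Set.InjOn g {i | i ≤ ℓ + 2} := by
    have hzero : g 0 = u := rfl
    intro i hi j hj hij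
    simp only [Set.InjOn, Set.mem_ofPred_eq] at hi hj hP
    rcases i with _ | i <;> rcases j with _ | j <;> grind
  obtain ⟨p, hp, hsupport⟩ := exists_alternating_path (v := v) hκ hgadj hginj rfl (by simp [hsucc])
  refine ⟨p, hp, fun x hx => ?_⟩
  obtain ⟨_ | i, -, rfl⟩ := hsupport x hx
  · exact .inl rfl
  · rw [hsucc]
    split_ifs with hi
    · exact .inr (.inr ⟨i, hi, rfl⟩)
    · exact .inr (.inl rfl)

theorem joinedBy_of_paths {ι : Type*} [Fintype ι] (hℓ : 2 ≤ ℓ) (P : ι → G.Walk u v)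
    (hP : ∀ a, (P a).IsPath ∧ (P a).length = ℓ ∧ IsAlternating c (P a))
    (hdisj : ∀ a b, a ≠ b → ∀ x ∈ (P a).support, x ∈ (P b).support → x = u ∨ x = v) :
    JoinedBy c ℓ (Fintype.card ι) u v := by
  have hinj : P.Injective := by
    intro a b hab
    by_contra hne
    obtain ⟨hpath, hlen, -⟩ := hP a
    have := hdisj a b hne _ ((P a).getVert_mem_support 1) (hab ▸ (P a).getVert_mem_support 1)
    rw [hpath.getVert_eq_start_iff (by omega), hpath.getVert_eq_end_iff (by omega)] at this
    omega
  let e := (Fintype.equivFin ι).symm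
  exact ⟨P ∘ e, hinj.comp e.injective, fun i => hP (e i),
    fun i j hij => hdisj (e i) (e j) (e.injective.ne hij)⟩

theorem joinedBy_of_levels {B : Type*} [Fintype B] [DecidableEq B] {κ : B → ℕ → K}
    (hκ : ∀ b i, κ b i ≠ κ b (i + 1)) {W : Finset V} (huv : u ≠ v) (hu : u ∉ W) (hv : v ∉ W)
    {pos : V → B × ℕ} {d s : ℕ} (hcard : ∀ b, ∀ i ≤ ℓ, d + ℓ * s ≤ #{x ∈ W | pos x = (b, i)})
    (hstart : ∀ b, ∀ x ∈ W, pos x = (b, 0) → (c.labelGraph (κ b 0)).Adj u x)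
    (hend : ∀ b, ∀ x ∈ W, pos x = (b, ℓ) → (c.labelGraph (κ b (ℓ + 1))).Adj x v)
    (hmix : ∀ b, ∀ i < ℓ, IsMixing (c.labelGraph (κ b (i + 1))).Adj s
      {x ∈ W | pos x = (b, i)} {x ∈ W | pos x = (b, i + 1)}) :
    JoinedBy c (ℓ + 2) (Fintype.card B * d) u v := by
  choose P hP hPadj hPinj using fun b =>
    exists_disjoint_transversals (L := fun i => {x ∈ W | pos x = (b, i)}) (hcard b) (hmix b)
  simp only [mem_filter] at hP
  have hPeq {b b' j j' i i'} (hi : i ≤ ℓ) (hi' : i' ≤ ℓ) (h : P b j i = P b' j' i') :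
      (b, j) = (b', j') ∧ i = i' := by
    obtain ⟨rfl, rfl⟩ := Prod.ext_iff.1 ((hP b j i hi).2.symm.trans (h ▸ (hP b' j' i' hi').2))
    exact ⟨congrArg _ (hPinj b i hi h), rfl⟩
  choose p hp hsupport using fun a : B × Fin d =>
    have hPa := hP a.1 a.2
    exists_alternating_path_of_interior (hκ a.1)
      (hstart _ _ (hPa 0 (by omega)).1 (hPa 0 (by omega)).2) (hPadj a.1 a.2)
      (hend _ _ (hPa ℓ le_rfl).1 (hPa ℓ le_rfl).2)
      (fun i hi j hj h => (hPeq hi hj h).2) huv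
      (fun i hi => ne_of_mem_of_not_mem (hPa i hi).1 hu)
      (fun i hi => ne_of_mem_of_not_mem (hPa i hi).1 hv)
  have hdisj (a b : B × Fin d) (hab : a ≠ b) (x) (hxa : x ∈ (p a).support)
      (hxb : x ∈ (p b).support) : x = u ∨ x = v := by
    obtain h | h | ⟨i, hi, rfl⟩ := hsupport a x hxa
    · exact .inl h
    · exact .inr h
    · obtain h | h | ⟨j, hj, h⟩ := hsupport b _ hxb
      · exact .inl h
      · exact .inr h
      · exact absurd (hPeq hj hi h).1.symm hab
  simpa using joinedBy_of_paths (by omega) p hp hdisj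

theorem IsAlternating.compRight {K' : Type*} {p : G.Walk u v} (hp : IsAlternating c p)
    {f : K → K'} (hf : f.Injective) : IsAlternating (c.compRight f) p :=
  hp.imp fun _ _ h => hf.ne h

theorem Connects.compRight {K' : Type*} {m n t : ℕ} {c : (Kmn m n).EdgeLabeling K}
    (hc : Connects c ℓ t) {f : K → K'} (hf : f.Injective) : Connects (c.compRight f) ℓ t :=
  fun u v huv =>
    let ⟨P, hinj, hP, hdisj⟩ := hc u v huv
    ⟨P, hinj, fun i => ⟨(hP i).1, (hP i).2.1, (hP i).2.2.compRight hf⟩, hdisj⟩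

end AlternatingPaths

section CompleteBipartite

variable {α β K : Type*}

/-- The edge colouring of the complete bipartite graph whose matrix of colours is `M`; it turns
sign patterns of Hadamard matrices into `2`-colourings. -/
def matrixColoring (M : α → β → K) : (completeBipartiteGraph α β).EdgeLabeling K :=
  .mk (fun
    | .inl a, .inr x, _ => M a x
    | .inr x, .inl a, _ => M a x)
    (by rintro (a | x) (a' | x') h <;> simp at h <;> rfl)

theorem labelGraph_matrixColoring_adj {M : α → β → K} {a : α} {x : β} {b : K} :
    ((matrixColoring M).labelGraph b).Adj (.inl a) (.inr x) ↔ M a x = b := by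
  rw [SimpleGraph.EdgeLabeling.labelGraph_adj]
  exact ⟨fun ⟨_, h⟩ => h, fun h => ⟨by simp, h⟩⟩

theorem IsMixing.labelGraph_matrixColoring {M : α → β → K} {b : K} {s : ℕ} {A : Finset α}
    {X : Finset β} (h : IsMixing (fun a x => M a x = b) s A X) :
    IsMixing ((matrixColoring M).labelGraph b).Adj s (A.map .inl) (X.map .inr) :=
  h.map _ _ fun _ _ => labelGraph_matrixColoring_adj.2

variable [Fintype α]

theorem exists_row_levels {h D : ℕ} (hh : 0 < h) {f g : α → Bool}
    (hf : ∀ b, (h + 1) * (D + 2) ≤ #{a | f a = b})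
    (hg : ∀ b, (h + 1) * (D + 2) ≤ #{a | g a = b}) :
    ∃ pos : α → Bool × ℕ, (∀ b, ∀ i ≤ h, D ≤ #{a | pos a = (b, i)}) ∧
      (∀ a b, pos a = (b, 0) → f a = b) ∧ ∀ a b, pos a = (b, h) → g a = !b := by
  obtain ⟨ρ, hρ⟩ := exists_equidistributed_fibers (ι := Fin (h + 1)) univ fun a => (f a, g a)
  have hcard {T : Finset (Bool × Bool)} (hT : #T = 2)
      (hTcard : (h + 1) * (D + 2) ≤ #{a | (f a, g a) ∈ T}) (i : Fin (h + 1)) :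
      D ≤ #{a | (f a, g a) ∈ T ∧ ρ a = i} := by
    have := hTcard.trans (hρ T i)
    rw [Fintype.card_fin, hT] at this
    simpa using Nat.le_of_mul_le_mul_left this h.succ_pos
  refine ⟨fun a => if ρ a = Fin.last h then (!g a, h) else (f a, ρ a), fun b i hi => ?_, ?_, ?_⟩
  · obtain rfl | hi := hi.eq_or_lt
    · refine (hcard (T := univ.filter fun p => p.2 = !b) (by cases b <;> rfl)
        (by simpa using hg (!b)) (Fin.last i)).trans (card_le_card ?_)
      grind
    · refine (hcard (T := univ.filter fun p => p.1 = b) (by cases b <;> rfl)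
        (by simpa using hf b) ⟨i, by omega⟩).trans (card_le_card ?_)
      grind
  · grind
  · intro a b hab
    have : b = !g a := by grind
    simp [this]

theorem exists_column_levels {h D : ℕ} {X : Finset β} (hX : 2 * h * (D + 1) ≤ #X) :
    ∃ pos : β → Bool × ℕ, ∀ b, ∀ i < h, D ≤ #{x ∈ X | pos x = (b, i)} := by
  obtain rfl | hh := h.eq_zero_or_pos
  · exact ⟨fun _ => (true, 0), by simp⟩
  have : NeZero h := ⟨hh.ne'⟩
  obtain ⟨χ, hχ⟩ := exists_equidistributed (ι := Bool × Fin h) X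
  refine ⟨fun x => ((χ x).1, (χ x).2), fun b i hi => ?_⟩
  have := hX.trans (hχ (b, ⟨i, hi⟩))
  simp only [Fintype.card_prod, Fintype.card_bool, Fintype.card_fin] at this
  simpa [Prod.ext_iff, Fin.ext_iff] using Nat.le_of_mul_le_mul_left this (by positivity)

theorem joinedBy_matrixColoring_of_levels {M : α → β → Bool} {X : Finset β} {h d s : ℕ} {u v : β}
    (huv : u ≠ v) (hu : u ∉ X) (hv : v ∉ X) {row : α → Bool × ℕ} {col : β → Bool × ℕ}
    (hrow : ∀ b, ∀ i ≤ h, d + 2 * h * s ≤ #{a | row a = (b, i)})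
    (hrow_zero : ∀ a b, row a = (b, 0) → M a u = b)
    (hrow_last : ∀ a b, row a = (b, h) → M a v = !b)
    (hcol : ∀ b, ∀ i < h, d + 2 * h * s ≤ #{x ∈ X | col x = (b, i)})
    (hmix : ∀ b, IsMixing (fun a x => M a x = b) s univ X) :
    JoinedBy (matrixColoring M) (2 * h + 2) (2 * d) (.inr u) (.inr v) := by
  classical
  let W : Finset (α ⊕ β) := univ.disjSum X
  let pos : α ⊕ β → Bool × ℕ :=
    Sum.elim (fun a => ((row a).1, 2 * (row a).2)) fun x => ((col x).1, 2 * (col x).2 + 1)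
  have heven (b : Bool) (j : ℕ) : {y ∈ W | pos y = (b, 2 * j)} =
      ({a | row a = (b, j)} : Finset α).map .inl := by
    ext (a | x)
    · simp [W, pos, Prod.ext_iff]
    · simp only [W, pos, mem_filter, Sum.elim_inr, Prod.ext_iff, Finset.mem_map,
        Function.Embedding.inl_apply, reduceCtorEq, and_false, exists_false, iff_false]
      omega
  have hodd (b : Bool) (j : ℕ) : {y ∈ W | pos y = (b, 2 * j + 1)} =
      ({x ∈ X | col x = (b, j)}).map .inr := by
    ext (a | x)
    · simp only [W, pos, mem_filter, Sum.elim_inl, Prod.ext_iff, Finset.mem_map,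
        Function.Embedding.inr_apply, reduceCtorEq, and_false, exists_false, iff_false]
      omega
    · simp [W, pos, Prod.ext_iff]
  have hmix_levels (b b' : Bool) (i j : ℕ) : IsMixing ((matrixColoring M).labelGraph b).Adj s
      (({a | row a = (b', i)} : Finset α).map .inl) (({x ∈ X | col x = (b', j)}).map .inr) :=
    ((hmix b).mono (subset_univ _) (filter_subset _ _)).labelGraph_matrixColoring
  refine joinedBy_of_levels (B := Bool) (κ := fun b i => xor b i.bodd) (W := W) (pos := pos)
    (s := s) (by simp) (by simpa using huv) (by simpa [W] using hu) (by simpa [W] using hv)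
    (fun b i hi => ?_) (fun b y hy hpos => ?_) (fun b y hy hpos => ?_) (fun b i hi => ?_)
  · obtain ⟨j, rfl | rfl⟩ := i.even_or_odd'
    · rw [heven, card_map]
      exact hrow b j (by omega)
    · rw [hodd, card_map]
      exact hcol b j (by omega)
  · have hy := (heven b 0).subset (mem_filter.2 ⟨hy, hpos⟩)
    obtain ⟨a, ha, rfl⟩ := mem_map.1 hy
    simpa using (labelGraph_matrixColoring_adj.2 (hrow_zero a b (mem_filter.1 ha).2)).symm
  · have hy := (heven b h).subset (mem_filter.2 ⟨hy, hpos⟩)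
    obtain ⟨a, ha, rfl⟩ := mem_map.1 hy
    simpa using labelGraph_matrixColoring_adj.2 (hrow_last a b (mem_filter.1 ha).2)
  · obtain ⟨j, rfl | rfl⟩ := i.even_or_odd'
    · rw [heven, hodd]
      exact hmix_levels _ b j j
    · rw [hodd, show 2 * j + 1 + 1 = 2 * (j + 1) by ring, heven]
      exact (hmix_levels _ b (j + 1) j).symm fun _ _ => SimpleGraph.Adj.symm

theorem joinedBy_matrixColoring {M : α → β → Bool} {S : Finset β} {h d s : ℕ} (hh : 0 < h)
    {u v : β} (huv : u ≠ v)
    (hu : ∀ b, (h + 1) * (d + 2 * h * s + 2) ≤ #{a | M a u = b})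
    (hv : ∀ b, (h + 1) * (d + 2 * h * s + 2) ≤ #{a | M a v = b})
    (hS : 2 * h * (d + 2 * h * s + 1) + 2 ≤ #S)
    (hmix : ∀ b, IsMixing (fun a x => M a x = b) s univ S) :
    JoinedBy (matrixColoring M) (2 * h + 2) (2 * d) (.inr u) (.inr v) := by
  classical
  have hX : 2 * h * (d + 2 * h * s + 1) ≤ #(S \ {u, v}) := by
    have := le_card_sdiff {u, v} S
    have := card_le_two (a := u) (b := v)
    omega
  -- A path that leaves `u` with colour `b` must reach `v` with colour `!b`.
  obtain ⟨row, hrow, hrow_zero, hrow_last⟩ := exists_row_levels hh hu hv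
  obtain ⟨col, hcol⟩ := exists_column_levels hX
  exact joinedBy_matrixColoring_of_levels huv (by simp) (by simp) hrow hrow_zero hrow_last hcol
    fun b => (hmix b).mono subset_rfl sdiff_subset

theorem mul_le_card_of_joinedBy {c : (completeBipartiteGraph α β).EdgeLabeling K} {k t : ℕ}
    {u v : β} (h : JoinedBy c (2 * k) t (.inr u) (.inr v)) : k * t ≤ Fintype.card α := by
  obtain ⟨P, -, hP, hdisj⟩ := h
  have hleft (p : Fin k × Fin t) : ∃ a, (P p.2).getVert (2 * p.1 + 1) = .inl a := by
    have heven := (SimpleGraph.CompleteBipartiteGraph.bicoloring α β).even_length_iff_congr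
      ((P p.2).take (2 * p.1 + 1))
    have hlen := (hP p.2).2.1
    rw [SimpleGraph.Walk.take_length, min_eq_left (by omega)] at heven
    generalize (P p.2).getVert (2 * p.1 + 1) = x at heven ⊢
    rcases x with a | x
    · exact ⟨a, rfl⟩
    · have hodd : ¬Even (2 * (p.1 : ℕ) + 1) := by simp [parity_simps]
      exact absurd (heven.2 Iff.rfl) hodd
  choose f hf using hleft
  have hinj : f.Injective := by
    rintro ⟨j, i⟩ ⟨j', i'⟩ h
    have heq : (P i).getVert (2 * j + 1) = (P i').getVert (2 * j' + 1) := by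
      rw [hf (j, i), hf (j', i'), h]
    obtain rfl : i = i' := by
      by_contra hne
      have := hdisj i i' hne (.inl (f (j, i))) (hf (j, i) ▸ (P i).getVert_mem_support _)
        (h ▸ hf (j', i') ▸ (P i').getVert_mem_support _)
      simp at this
    obtain ⟨hpath, hlen, -⟩ := hP i
    have := hpath.getVert_injOn (by simp; omega) (by simp; omega) heq
    simp only [Prod.mk.injEq, and_true]
    omega
  simpa using Fintype.card_le_of_injective f hinj

end CompleteBipartite

/-- The number of alternating paths of length `2 * k` that the construction below produces between
any two vertices of the larger class, when the smaller one has `m` elements. A chain of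
levels has `2 * k - 2` links, each of which loses `4 * m.sqrt` vertices; the remaining `2` comes
from rounding when the levels are cut out. The truncated subtraction makes it `0` for small `m`. -/
def pathCount (k m : ℕ) : ℕ :=
  2 * (m / (2 * k) - (8 * (k - 1) * m.sqrt + 2))

theorem joinedBy_zero {V K : Type*} {G : SimpleGraph V} (c : G.EdgeLabeling K) (ℓ : ℕ) (u v : V) :
    JoinedBy c ℓ 0 u v :=
  ⟨Fin.elim0, fun i => i.elim0, fun i => i.elim0, fun i => i.elim0⟩

theorem exists_bool_coloring_connects {k m n : ℕ} (hk : 2 ≤ k) (hm : 0 < m) (hmn : m ≤ n) :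
    ∃ c : (Kmn m n).EdgeLabeling Bool, Connects c (2 * k) (pathCount k m) := by
  obtain ⟨M, hbalanced, hmix⟩ := exists_balanced_mixing_matrix hm n
  refine ⟨matrixColoring M, fun u v huv => ?_⟩
  obtain ⟨h, rfl⟩ : ∃ h, k = h + 1 := ⟨k - 1, by omega⟩
  obtain hsmall | hlarge := le_or_gt (m / (2 * (h + 1))) (8 * h * m.sqrt + 2)
  · rw [pathCount, Nat.add_sub_cancel, Nat.sub_eq_zero_of_le hsmall]
    exact joinedBy_zero _ _ _ _
  · rw [pathCount, Nat.add_sub_cancel]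
    set d := m / (2 * (h + 1)) - (8 * h * m.sqrt + 2)
    have hd : 2 * ((h + 1) * (d + 2 * h * (4 * m.sqrt) + 2)) ≤ m := calc
      _ = 2 * (h + 1) * (d + (8 * h * m.sqrt + 2)) := by ring
      _ = 2 * (h + 1) * (m / (2 * (h + 1))) := by rw [Nat.sub_add_cancel hlarge.le]
      _ ≤ m := Nat.mul_div_le _ _
    have hrow (x : Fin n) (b : Bool) :
        (h + 1) * (d + 2 * h * (4 * m.sqrt) + 2) ≤ #{a | M a x = b} :=
      le_trans (by omega) (hbalanced x b)
    have hcol : 2 * h * (d + 2 * h * (4 * m.sqrt) + 1) + 2 ≤ #{x : Fin n | x.val < m} := by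
      rw [Fin.card_filter_val_lt, min_eq_right hmn]
      generalize d + 2 * h * (4 * m.sqrt) = D at hd ⊢
      linarith only [hd]
    exact joinedBy_matrixColoring (by omega) huv (hrow u) (hrow v) hcol hmix

theorem exists_two_coloring_connects {r k m n : ℕ} (hr : 2 ≤ r) (hk : 2 ≤ k) (hm : 0 < m)
    (hmn : m ≤ n) : ∃ c : (Kmn m n).EdgeLabeling (Fin r),
      (Set.range c).ncard ≤ 2 ∧ Connects c (2 * k) (pathCount k m) := by
  obtain ⟨c, hc⟩ := exists_bool_coloring_connects hk hm hmn
  obtain ⟨f⟩ : Nonempty (Bool ↪ Fin r) := Function.Embedding.nonempty_of_card_le (by simpa)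
  refine ⟨c.compRight f, ?_, hc.compRight f.injective⟩
  calc (Set.range (f ∘ c)).ncard ≤ (Set.range f).ncard :=
        Set.ncard_le_ncard (Set.range_comp_subset_range c f) (Set.finite_range f)
    _ = 2 := by simp

theorem sub_le_pathCount {k : ℕ} (hk : 0 < k) (m : ℕ) :
    (m : ℝ) / k - 16 * k * √m ≤ pathCount k m := by
  obtain ⟨h, rfl⟩ : ∃ h, k = h + 1 := ⟨k - 1, by omega⟩
  obtain rfl | hm := m.eq_zero_or_pos
  · simp
  have hsqrt : (m.sqrt : ℝ) ≤ √m := Real.nat_sqrt_le_real_sqrt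
  have hone : 1 ≤ √(m : ℝ) := Real.one_le_sqrt.2 (mod_cast hm)
  have hfloor : (m : ℝ) / (2 * (h + 1)) ≤ (m / (2 * (h + 1)) : ℕ) + 1 := by
    rw [div_le_iff₀ (by positivity), mul_comm]
    exact_mod_cast (Nat.lt_mul_div_succ m (by positivity)).le
  have hsub : ((m / (2 * (h + 1)) : ℕ) : ℝ) ≤
      (m / (2 * (h + 1)) - (8 * h * m.sqrt + 2) : ℕ) + (8 * h * m.sqrt + 2) :=
    mod_cast le_tsub_add
  have hhalf : (m : ℝ) / (h + 1) = 2 * (m / (2 * (h + 1))) := by field_simp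
  rw [pathCount, Nat.add_sub_cancel]
  push_cast [hhalf]
  nlinarith [mul_le_mul_of_nonneg_left hsqrt h.cast_nonneg]

theorem kappa_le_div {r k m n : ℕ} (hr : 1 ≤ r) (hk : 1 ≤ k) (hn : 2 ≤ n) :
    (kappa r (2 * k) m n : ℝ) ≤ m / k := by
  obtain ⟨c, hc⟩ := (isGreatest_kappa (m := m) hr (show 2 ≤ 2 * k by omega) hn).1
  have hcard := mul_le_card_of_joinedBy (hc ⟨0, by omega⟩ ⟨1, by omega⟩ (by simp))
  rw [Fintype.card_fin, mul_comm] at hcard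
  exact (le_div_iff₀ (mod_cast hk)).2 (mod_cast hcard)

theorem isEquivalent_div_of_sub_sqrt_le {α : Type*} {l : Filter α} {f m : α → ℝ} {k C : ℝ}
    (hk : k ≠ 0) (hm : Tendsto m l atTop) (hlower : ∀ᶠ x in l, m x / k - C * √(m x) ≤ f x)
    (hupper : ∀ᶠ x in l, f x ≤ m x / k) : f ~[l] fun x => m x / k := by
  have hsqrt : (fun x : ℝ => √x) =o[atTop] fun x : ℝ => x := by
    refine isLittleO_of_tendsto' ?_ ?_
    · filter_upwards [eventually_gt_atTop 0] with x hx h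
      exact absurd h hx.ne'
    · simpa only [Real.sqrt_div_self', one_div] using!
        Real.tendsto_sqrt_atTop.inv_tendsto_atTop
  have hbound : (fun x => f x - m x / k) =O[l] fun x => √(m x) := by
    refine .of_bound C ?_
    filter_upwards [hlower, hupper] with x hx hx'
    rw [Real.norm_of_nonpos (by linarith), Real.norm_of_nonneg (Real.sqrt_nonneg _)]
    linarith
  have hlittle : (fun x => f x - m x / k) =o[l] m := hbound.trans_isLittleO (hsqrt.comp_tendsto hm)
  simp only [div_eq_inv_mul] at hlittle ⊢
  exact (hlittle.const_mul_right (inv_ne_zero hk)).isEquivalent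

end AltPaths

theorem theorem3p1 (r k : ℕ) (hr : 2 ≤ r) (hk : 2 ≤ k) (m : ℕ → ℕ)
    (hmn : ∀ᶠ n in atTop, m n ≤ n) (hm : Tendsto m atTop atTop) :
    (fun n => (AltPaths.kappa r (2 * k) (m n) n : ℝ)) ~[atTop] (fun n => (m n : ℝ) / k) ∧
    ∃ t : ℕ → ℕ, (fun n => (t n : ℝ)) ~[atTop] (fun n => (m n : ℝ) / k) ∧
      ∀ᶠ n in atTop, ∃ c : (AltPaths.Kmn (m n) n).EdgeLabeling (Fin r),
        (Set.range c).ncard ≤ 2 ∧ AltPaths.Connects c (2 * k) (t n) := by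
  have hk0 : (k : ℝ) ≠ 0 := by positivity
  have hm' : Tendsto (fun n => (m n : ℝ)) atTop atTop := tendsto_natCast_atTop_atTop.comp hm
  have hlower (n) := AltPaths.sub_le_pathCount (k := k) (by omega) (m n)
  have hcoloring : ∀ᶠ n in atTop, ∃ c : (AltPaths.Kmn (m n) n).EdgeLabeling (Fin r),
      (Set.range c).ncard ≤ 2 ∧ AltPaths.Connects c (2 * k) (AltPaths.pathCount k (m n)) := by
    filter_upwards [hmn, hm.eventually_gt_atTop 0] with n hn hn'
    exact AltPaths.exists_two_coloring_connects hr hk hn' hn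
  have hle_kappa : ∀ᶠ n in atTop,
      AltPaths.pathCount k (m n) ≤ AltPaths.kappa r (2 * k) (m n) n := by
    filter_upwards [hcoloring, eventually_ge_atTop 2] with n ⟨c, _, hc⟩ hn
    exact (AltPaths.isGreatest_kappa (by omega) (by omega) hn).2 ⟨c, hc⟩
  have hkappa_le : ∀ᶠ n in atTop, (AltPaths.kappa r (2 * k) (m n) n : ℝ) ≤ m n / k := by
    filter_upwards [eventually_ge_atTop 2] with n hn
    exact AltPaths.kappa_le_div (by omega) (by omega) hn
  refine ⟨AltPaths.isEquivalent_div_of_sub_sqrt_le (C := 16 * k) hk0 hm' ?_ hkappa_le, _,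
    AltPaths.isEquivalent_div_of_sub_sqrt_le hk0 hm' (.of_forall hlower) ?_, hcoloring⟩
  · filter_upwards [hle_kappa] with n hn using (hlower n).trans (mod_cast hn)
  · filter_upwards [hle_kappa, hkappa_le] with n hn hn' using le_trans (mod_cast hn) hn'
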